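/- Let $n\ge 1$ and $1<p<\infty$. All cubes in $\mathbb{R}^n$ are closed, nondegenerate, with sides parallel to the coordinate axes. For a cube $Q_0\subset\mathbb{R}^n$ let $P(Q_0)$ be the set of all countable (finite or infinite) families $\{Q_i\}$ of subcubes of $Q_0$ with pairwise disjoint interiors. For $f\in L^1(Q_0)$ (real-valued) let $f_{Q_0}=\frac1{|Q_0|}\int_{Q_0}f\,dx$, and define $$\|f\|_{GaRo_p(Q_0)}=\inf\Big\{C>0:\ \sum_i\frac1{|Q_i|}\int_{Q_i}\int_{Q_i}|f(x)-f(y)|\,dx\,dy\le C\Big(\sum_i|Q_i|\Big)^{1-1/p}\ \text{ for all }\{Q_i\}\in P(Q_0)\Big\}\in[0,\infty]$$ (with $\inf\emptyset=\infty$) and $$\|f\|^*_{L(p,\infty)}=\sup_{t>0}t^{1/p}f^*(t)\in[0,\infty],\qquad f^*(t)=\inf\{s\ge0:\ |\{x\in Q_0:|f(x)|>s\}|\le t\}.$$ Then for every cube $Q_0\subset\mathbb{R}^n$ and every $f\in L^1(Q_0)$, $$\|f-f_{Q_0}\|_{GaRo_p(Q_0)}\le\frac{2p}{p-1}\,\|f-f_{Q_0}\|^*_{L(p,\infty)},$$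 and there is a constant $c(n,p)\in(0,\infty)$, depending only on $n$ and $p$, such that for every cube $Q_0\subset\mathbb{R}^n$ and every $f\in L^1(Q_0)$, $$\|f-f_{Q_0}\|^*_{L(p,\infty)}\le c(n,p)\,\|f-f_{Q_0}\|_{GaRo_p(Q_0)}.$$ -/

import Mathlib

open MeasureTheory
open scoped NNReal ENNReal

noncomputable section

/-- A (closed, nondegenerate) cube in `ℝⁿ` with sides parallel to the coordinate axes, given by its
lower corner and its side length. -/
structure AxisCube (n : ℕ) where
  corner : Fin n → ℝ
  side : ℝ
  side_pos : 0 < side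

/-- The set of points of a cube. -/
def AxisCube.toSet {n : ℕ} (Q : AxisCube n) : Set (Fin n → ℝ) :=
  Set.Icc Q.corner (fun i => Q.corner i + Q.side)

/-- `S` belongs to `P(Q₀)`: a countable (possibly finite) family of subcubes of `Q₀` with pairwise
disjoint interiors. -/
def IsPacking {n : ℕ} (Q₀ : AxisCube n) (S : Set (AxisCube n)) : Prop :=
  S.Countable ∧ (∀ Q ∈ S, Q.toSet ⊆ Q₀.toSet) ∧
    S.PairwiseDisjoint (fun Q => interior Q.toSet)

/-- The Garsia-Rodemich condition with constant `C`: for all families `{Qᵢ}` in `P(Q₀)`,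
`∑ᵢ |Qᵢ|⁻¹ ∫_{Qᵢ} ∫_{Qᵢ} |f(x) - f(y)| dx dy ≤ C (∑ᵢ |Qᵢ|)^{1 - 1/p}`. -/
def GaRoCondition {n : ℕ} (p : ℝ) (Q₀ : AxisCube n) (f : (Fin n → ℝ) → ℝ) (C : ℝ≥0) : Prop :=
  ∀ S : Set (AxisCube n), IsPacking Q₀ S →
    ∑' Q : S, (volume Q.1.toSet)⁻¹ *
        ∫⁻ y in Q.1.toSet, ∫⁻ x in Q.1.toSet, ‖f x - f y‖ₑ
      ≤ (C : ℝ≥0∞) * (∑' Q : S, volume Q.1.toSet) ^ (1 - 1 / p)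

/-- The `GaRo_p(Q₀)` norm, the infimum of the finite constants `C > 0` in the Garsia-Rodemich
condition; it is `∞` if there is no such constant. -/
def gaRoNorm {n : ℕ} (p : ℝ) (Q₀ : AxisCube n) (f : (Fin n → ℝ) → ℝ) : ℝ≥0∞ :=
  ⨅ (C : ℝ≥0) (_ : 0 < C ∧ GaRoCondition p Q₀ f C), (C : ℝ≥0∞)

/-- The non-increasing rearrangement on `Q₀`:
`f*(t) = inf {s ≥ 0 : |{x ∈ Q₀ : |f(x)| > s}| ≤ t}`. -/
def rearrangement {n : ℕ} (Q₀ : AxisCube n) (f : (Fin n → ℝ) → ℝ) (t : ℝ≥0) : ℝ≥0∞ :=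
  sInf {s : ℝ≥0∞ | volume {x | x ∈ Q₀.toSet ∧ s < ‖f x‖ₑ} ≤ (t : ℝ≥0∞)}

/-- The weak-`L^p` quasinorm on `Q₀`: `sup_{t > 0} t^{1/p} f*(t)`. -/
def weakLpNorm {n : ℕ} (p : ℝ) (Q₀ : AxisCube n) (f : (Fin n → ℝ) → ℝ) : ℝ≥0∞ :=
  ⨆ (t : ℝ≥0) (_ : 0 < t), (t : ℝ≥0∞) ^ (1 / p) * rearrangement Q₀ f t

/-- The function `f - f_{Q₀}`, where `f_{Q₀}` is the mean value of `f` over `Q₀`. -/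
def subMean {n : ℕ} (Q₀ : AxisCube n) (f : (Fin n → ℝ) → ℝ) : (Fin n → ℝ) → ℝ :=
  fun x => f x - ⨍ y in Q₀.toSet, f y

end

/-! Write `g = f - f_Q`. For the first bound, the oscillation over a cube is at most `2 ∫ |g|`.
Summed over a packing this gives `2 ∫_E |g|` with `E` the union of its cubes, and the layer-cake
formula bounds `∫_E |g|` by `p / (p - 1) * w * |E| ^ (1 - 1 / p)` for every `w` above the weak norm
(`lintegral_enorm_le_of_distribution_le`).

The converse is a Calderón-Zygmund argument. Let `V s` be the total volume of the maximal dyadic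
subcubes on which the mean of `|g|` exceeds `s`. By Lebesgue differentiation, `V s` bounds the
distribution function of `g`. Put `L = 2 ^ (n + 1)`. A cube of height `L * s` lies in one of height
`s`, whose mean is at most `2 ^ n * s`, so on the small cube `g` deviates from its values on the
large one by at least `2 ^ n * s` on average. Testing the Garsia-Rodemich condition on the cubes of
height `s` gives `2 ^ n * s * V (L * s) ≤ C * V s ^ (1 - 1 / p)` (`stoppingVolume_decay`). Iterating
from a height where `V ≤ |Q|` suffices yields `V s ≤ (L ^ p * C / s) ^ p`, hence the constant `L ^
p`. -/

/-- The integral form of the embedding of weak `L^p` into `L¹` of a finite measure. -/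
theorem lintegral_enorm_le_of_distribution_le {α : Type*} [MeasurableSpace α] (μ : Measure α)
    [IsFiniteMeasure μ] {g : α → ℝ} (hg : AEMeasurable g μ) {p w : ℝ} (hp : 1 < p) (hw : 0 < w)
    (h : ∀ s : ℝ, 0 < s → μ {x | s < |g x|} ≤ ENNReal.ofReal ((w / s) ^ p)) :
    ∫⁻ x, ‖g x‖ₑ ∂μ ≤ ENNReal.ofReal (w * p / (p - 1)) * μ Set.univ ^ (1 - 1 / p) := by
  rcases eq_or_ne μ 0 with rfl | hμ
  · simp
  have hp0 : 0 < p := by linarith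
  have hp1 : 0 < p - 1 := by linarith
  set V : ℝ := (μ Set.univ).toReal with hV
  have hVpos : 0 < V := ENNReal.toReal_pos (by simpa using hμ) (measure_ne_top _ _)
  have hVe : μ Set.univ = ENNReal.ofReal V := (ENNReal.ofReal_toReal (measure_ne_top _ _)).symm
  -- The height at which `(w / s) ^ p` equals the total mass `V`: below it the trivial bound `V` is
  -- better, above it the hypothesis.
  set s₀ : ℝ := w * V ^ (-(1 / p)) with hs₀
  have hs₀pos : 0 < s₀ := by positivity
  have key : ∫⁻ x, ‖g x‖ₑ ∂μ = ∫⁻ t in Set.Ioi (0 : ℝ), μ {a | t < |g a|} := by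
    rw [← lintegral_eq_lintegral_meas_lt μ (Filter.Eventually.of_forall fun x => abs_nonneg (g x))
      (by simpa [Real.norm_eq_abs] using hg.norm)]
    simp_rw [Real.enorm_eq_ofReal_abs]
  have hsplit : Set.Ioi (0 : ℝ) = Set.Ioc 0 s₀ ∪ Set.Ioi s₀ :=
    (Set.Ioc_union_Ioi_eq_Ioi hs₀pos.le).symm
  have h1 : ∫⁻ t in Set.Ioc (0 : ℝ) s₀, μ {a | t < |g a|} ≤ ENNReal.ofReal (V * s₀) := by
    calc _ ≤ ∫⁻ _ in Set.Ioc (0 : ℝ) s₀, ENNReal.ofReal V :=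
          lintegral_mono fun t => hVe ▸ measure_mono (Set.subset_univ _)
      _ = _ := by rw [setLIntegral_const, Real.volume_Ioc, sub_zero, ENNReal.ofReal_mul hVpos.le]
  have h2 : ∫⁻ t in Set.Ioi s₀, μ {a | t < |g a|}
      ≤ ENNReal.ofReal (w ^ p * (s₀ ^ (1 - p) / (p - 1))) := by
    have hint := (integrableOn_Ioi_rpow_of_lt (a := -p) (by linarith) hs₀pos).const_mul (w ^ p)
    calc _ ≤ ∫⁻ t in Set.Ioi s₀, ENNReal.ofReal (w ^ p * t ^ (-p)) := by
          refine setLIntegral_mono' measurableSet_Ioi fun t ht => ?_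
          have ht0 : 0 < t := hs₀pos.trans ht
          rw [Real.rpow_neg ht0.le, ← div_eq_mul_inv, ← Real.div_rpow hw.le ht0.le]
          exact h t ht0
      _ = _ := by
          rw [← ofReal_integral_eq_lintegral_ofReal hint, integral_const_mul,
            integral_Ioi_rpow_of_lt (by linarith) hs₀pos]
          · congr 2
            rw [show -p + 1 = -(p - 1) by ring, neg_div_neg_eq, neg_sub]
          · filter_upwards [self_mem_ae_restrict measurableSet_Ioi] with t ht
            have ht0 : 0 < t := hs₀pos.trans ht
            simp only [Pi.zero_apply]
            positivity
  rw [key, hsplit, lintegral_union measurableSet_Ioi (Set.Ioc_disjoint_Ioi le_rfl)]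
  refine (add_le_add h1 h2).trans ?_
  rw [← ENNReal.ofReal_add (by positivity) (by positivity), hVe,
    ENNReal.ofReal_rpow_of_pos hVpos, ← ENNReal.ofReal_mul (by positivity)]
  refine ENNReal.ofReal_le_ofReal (le_of_eq ?_)
  have e1 : V * s₀ = w * V ^ (1 - 1 / p) := by
    rw [hs₀, sub_eq_add_neg, Real.rpow_add hVpos, Real.rpow_one]; ring
  have e2 : w ^ p * s₀ ^ (1 - p) = w * V ^ (1 - 1 / p) := by
    rw [hs₀, Real.mul_rpow hw.le (by positivity), ← mul_assoc, ← Real.rpow_add hw,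
      ← Real.rpow_mul hVpos.le]
    congr 1
    · simp
    · congr 1; field_simp; ring
  rw [← mul_div_assoc, e2, e1]
  field_simp
  ring

/-! ### Cubes and packings. -/

namespace AxisCube

variable {n : ℕ}

theorem toSet_eq_pi (Q : AxisCube n) :
    Q.toSet = Set.univ.pi fun i => Set.Icc (Q.corner i) (Q.corner i + Q.side) :=
  (Set.pi_univ_Icc _ _).symm

theorem measurableSet_toSet (Q : AxisCube n) : MeasurableSet Q.toSet := measurableSet_Icc

theorem volume_toSet (Q : AxisCube n) : volume Q.toSet = ENNReal.ofReal (Q.side ^ n) := by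
  rw [toSet, Real.volume_Icc_pi]
  simp [ENNReal.ofReal_pow Q.side_pos.le]

theorem volume_toSet_ne_top (Q : AxisCube n) : volume Q.toSet ≠ ∞ := by
  simp [volume_toSet]

theorem volume_toSet_ne_zero (Q : AxisCube n) : volume Q.toSet ≠ 0 := by
  have := Q.side_pos
  simp only [volume_toSet, ne_eq, ENNReal.ofReal_eq_zero, not_le]
  positivity

theorem interior_toSet_ae_eq (Q : AxisCube n) : interior Q.toSet =ᵐ[volume] Q.toSet := by
  rw [toSet_eq_pi, interior_pi_set Set.finite_univ]
  simp only [interior_Icc]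
  rw [Set.pi_univ_Icc]
  exact Measure.univ_pi_Ioo_ae_eq_Icc

end AxisCube

variable {n : ℕ}

/-- The cubes of a packing are almost everywhere disjoint. -/
theorem IsPacking.lintegral_biUnion {Q₀ : AxisCube n} {S : Set (AxisCube n)} (hS : IsPacking Q₀ S)
    (F : (Fin n → ℝ) → ℝ≥0∞) :
    ∫⁻ x in ⋃ Q ∈ S, Q.toSet, F x = ∑' Q : S, ∫⁻ x in Q.1.toSet, F x := by
  refine lintegral_biUnion₀ hS.1 (fun Q _ => Q.measurableSet_toSet.nullMeasurableSet) ?_ F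
  intro Q hQ R hR hne
  have := hS.2.2 hQ hR hne
  exact this.aedisjoint.congr Q.interior_toSet_ae_eq.symm R.interior_toSet_ae_eq.symm

/-! ### From weak `L^p` to the Garsia-Rodemich space. -/

/-- The mean oscillation of `f` over a cube is at most twice the integral of `|f|`. -/
theorem inv_volume_mul_oscillation_le (Q : AxisCube n) (f : (Fin n → ℝ) → ℝ) :
    (volume Q.toSet)⁻¹ * ∫⁻ y in Q.toSet, ∫⁻ x in Q.toSet, ‖f x - f y‖ₑ
      ≤ 2 * ∫⁻ x in Q.toSet, ‖f x‖ₑ := by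
  set I := ∫⁻ x in Q.toSet, ‖f x‖ₑ
  have h1 : ∀ y, ∫⁻ x in Q.toSet, ‖f x - f y‖ₑ ≤ I + ‖f y‖ₑ * volume Q.toSet := fun y => by
    calc _ ≤ ∫⁻ x in Q.toSet, (‖f x‖ₑ + ‖f y‖ₑ) := lintegral_mono fun x => enorm_sub_le
      _ = _ := by rw [lintegral_add_right _ measurable_const, setLIntegral_const]
  have h2 : ∫⁻ y in Q.toSet, ∫⁻ x in Q.toSet, ‖f x - f y‖ₑ ≤ volume Q.toSet * (2 * I) := by
    calc _ ≤ ∫⁻ y in Q.toSet, (I + ‖f y‖ₑ * volume Q.toSet) := lintegral_mono h1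
      _ = _ := by
        rw [lintegral_add_left measurable_const, setLIntegral_const,
          lintegral_mul_const' _ _ Q.volume_toSet_ne_top]
        ring
  calc _ ≤ (volume Q.toSet)⁻¹ * (volume Q.toSet * (2 * I)) := by gcongr
    _ = _ := by
      rw [← mul_assoc, ENNReal.inv_mul_cancel Q.volume_toSet_ne_zero Q.volume_toSet_ne_top, one_mul]

/-- The distribution function is controlled by the weak `L^p` quasinorm. -/
theorem volume_lt_enorm_le_of_weakLpNorm_le {p : ℝ} (hp : 0 < p) {Q₀ : AxisCube n}
    {g : (Fin n → ℝ) → ℝ} {w : ℝ} (hw : 0 < w) (h : weakLpNorm p Q₀ g ≤ ENNReal.ofReal w) {s : ℝ}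
    (hs : 0 < s) :
    volume {x | x ∈ Q₀.toSet ∧ ENNReal.ofReal s < ‖g x‖ₑ} ≤ ENNReal.ofReal ((w / s) ^ p) := by
  by_contra! hlt
  -- For `t` strictly between the two sides, the rearrangement at `t` is at least `s`, so `t ^ (1 /
  -- p) * s ≤ w`, contradicting `(w / s) ^ p < t`.
  obtain ⟨t, ht1, ht2⟩ := ENNReal.lt_iff_exists_nnreal_btwn.1 hlt
  have hpos : 0 < (w / s) ^ p := by positivity
  have ht1' : (w / s) ^ p < t := by
    rw [← ENNReal.ofReal_coe_nnreal] at ht1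
    exact (ENNReal.ofReal_lt_ofReal_iff_of_nonneg hpos.le).1 ht1
  have ht0 : 0 < t := by exact_mod_cast hpos.trans ht1'
  have hr : ENNReal.ofReal s ≤ rearrangement Q₀ g t := by
    refine le_sInf fun s' hs' => ?_
    by_contra! hcon
    refine absurd (ht2.trans_le (measure_mono ?_)) (not_lt.2 hs')
    exact fun x hx => ⟨hx.1, hcon.trans hx.2⟩
  have h3 : (t : ℝ≥0∞) ^ (1 / p) * ENNReal.ofReal s ≤ ENNReal.ofReal w := by
    refine le_trans ?_ h
    refine le_trans ?_ (le_iSup₂ (f := fun (t : ℝ≥0) (_ : 0 < t) =>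
      (t : ℝ≥0∞) ^ (1 / p) * rearrangement Q₀ g t) t ht0)
    gcongr
  rw [← ENNReal.ofReal_coe_nnreal, ENNReal.ofReal_rpow_of_pos (by exact_mod_cast ht0),
    ← ENNReal.ofReal_mul (by positivity), ENNReal.ofReal_le_ofReal_iff hw.le,
    ← le_div_iff₀ hs] at h3
  refine absurd ht1' (not_lt.2 ?_)
  calc (t : ℝ) = ((t : ℝ) ^ (1 / p)) ^ p := by
        rw [← Real.rpow_mul t.coe_nonneg, one_div_mul_cancel hp.ne', Real.rpow_one]
    _ ≤ _ := by gcongr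

/-- The embedding of weak `L^p` into the Garsia-Rodemich space. -/
theorem gaRoNorm_le_weakLpNorm {p : ℝ} (hp : 1 < p) {Q₀ : AxisCube n} {g : (Fin n → ℝ) → ℝ}
    (hg : AEMeasurable g (volume.restrict Q₀.toSet)) :
    gaRoNorm p Q₀ g ≤ ENNReal.ofReal (2 * p / (p - 1)) * weakLpNorm p Q₀ g := by
  have hp1 : 0 < p - 1 := by linarith
  have hA : 0 < 2 * p / (p - 1) := by positivity
  rw [mul_comm, ← ENNReal.div_le_iff (by simpa using hA) (by simp)]
  -- Admissible constants must be positive and finite, so the weak norm, possibly `0` or `∞`, is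
  -- approached from above.
  refine le_of_forall_gt_imp_ge_of_dense fun w hw => ?_
  rcases eq_or_ne w ∞ with rfl | hw_top
  · exact le_top
  lift w to ℝ≥0 using hw_top
  have hw0 : 0 < w := ENNReal.coe_pos.1 hw.bot_lt
  rw [ENNReal.div_le_iff (by simpa using hA) (by simp)]
  set C : ℝ≥0 := w * Real.toNNReal (2 * p / (p - 1)) with hC
  have hCe : (w : ℝ≥0∞) * ENNReal.ofReal (2 * p / (p - 1)) = C := by
    rw [hC, ENNReal.coe_mul, ENNReal.ofReal]
  rw [hCe]
  refine iInf₂_le C ⟨mul_pos hw0 (Real.toNNReal_pos.2 hA), fun S hS => ?_⟩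
  have hsub : (⋃ Q ∈ S, Q.toSet) ⊆ Q₀.toSet := Set.iUnion₂_subset hS.2.1
  have hvol : ∑' Q : S, volume Q.1.toSet = volume (⋃ Q ∈ S, Q.toSet) := by
    simpa using (hS.lintegral_biUnion fun _ => 1).symm
  rw [hvol]
  have hfin : IsFiniteMeasure (volume.restrict (⋃ Q ∈ S, Q.toSet)) :=
    ⟨by simpa using (measure_mono hsub).trans_lt Q₀.volume_toSet_ne_top.lt_top⟩
  calc _ ≤ ∑' Q : S, 2 * ∫⁻ x in Q.1.toSet, ‖g x‖ₑ :=
        ENNReal.tsum_le_tsum fun Q => inv_volume_mul_oscillation_le Q.1 g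
    _ = 2 * ∫⁻ x in ⋃ Q ∈ S, Q.toSet, ‖g x‖ₑ := by
        rw [ENNReal.tsum_mul_left, hS.lintegral_biUnion]
    _ ≤ 2 * (ENNReal.ofReal (w * p / (p - 1)) *
          volume.restrict (⋃ Q ∈ S, Q.toSet) Set.univ ^ (1 - 1 / p)) := by
        gcongr
        refine lintegral_enorm_le_of_distribution_le _
          (hg.mono_measure (Measure.restrict_mono hsub le_rfl)) hp (by exact_mod_cast hw0) ?_
        intro s hs
        refine le_trans ?_ (volume_lt_enorm_le_of_weakLpNorm_le (Q₀ := Q₀) (g := g) (by linarith)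
          (by exact_mod_cast hw0) (by simpa using hw.le) hs)
        refine (Measure.restrict_mono hsub le_rfl _).trans ?_
        rw [Measure.restrict_apply' Q₀.measurableSet_toSet]
        refine measure_mono fun x hx => ⟨hx.2, ?_⟩
        rw [Real.enorm_eq_ofReal_abs]
        exact (ENNReal.ofReal_lt_ofReal_iff_of_nonneg hs.le).2 hx.1
    _ = _ := by
        rw [Measure.restrict_apply_univ, ← mul_assoc, ← hCe, ← ENNReal.ofReal_coe_nnreal,
          ← ENNReal.ofReal_mul w.coe_nonneg, show (2 : ℝ≥0∞) = ENNReal.ofReal 2 by simp,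
          ← ENNReal.ofReal_mul (by norm_num)]
        congr 2
        ring

/-! ### Dyadic cubes: half-open cells for exact disjointness, closed cubes for packings. -/

namespace AxisCube

/-- The index of the half-open dyadic cube of generation `m` relative to `Q` that contains `x`. -/
noncomputable def dyadicIndex (Q : AxisCube n) (m : ℕ) (x : Fin n → ℝ) : Fin n → ℤ :=
  fun i => ⌊(x i - Q.corner i) / Q.side * 2 ^ m⌋

/-- The closed dyadic cube of generation `m` and index `k` relative to `Q`. -/
noncomputable def dyadicCube (Q : AxisCube n) (m : ℕ) (k : Fin n → ℤ) : AxisCube n where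
  corner i := Q.corner i + Q.side * k i / 2 ^ m
  side := Q.side / 2 ^ m
  side_pos := div_pos Q.side_pos (by positivity)

/-- The half-open dyadic cube of generation `m` and index `k` relative to `Q`. -/
noncomputable def dyadicCell (Q : AxisCube n) (m : ℕ) (k : Fin n → ℤ) : Set (Fin n → ℝ) :=
  {x | Q.dyadicIndex m x = k}

variable (Q : AxisCube n)

theorem dyadicCell_eq_pi (m : ℕ) (k : Fin n → ℤ) :
    Q.dyadicCell m k = Set.univ.pi fun i => Set.Ico ((Q.dyadicCube m k).corner i)
      ((Q.dyadicCube m k).corner i + (Q.dyadicCube m k).side) := by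
  ext x
  have hl := Q.side_pos
  have h2 : (0 : ℝ) < 2 ^ m := by positivity
  simp only [dyadicCell, Set.mem_ofPred_eq, funext_iff, dyadicIndex, Int.floor_eq_iff, Set.mem_pi,
    Set.mem_univ, true_imp_iff, Set.mem_Ico, dyadicCube]
  refine forall_congr' fun i => and_congr ?_ ?_
  · rw [div_mul_eq_mul_div, le_div_iff₀ hl, ← le_sub_iff_add_le', div_le_iff₀ h2, mul_comm Q.side]
  · rw [div_mul_eq_mul_div, div_lt_iff₀ hl, add_assoc, ← add_div, ← sub_lt_iff_lt_add',
      lt_div_iff₀ h2]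
    congr! 1
    ring

theorem dyadicCell_subset_toSet (m : ℕ) (k : Fin n → ℤ) :
    Q.dyadicCell m k ⊆ (Q.dyadicCube m k).toSet := by
  rw [dyadicCell_eq_pi, toSet_eq_pi]
  exact Set.pi_mono fun i _ => Set.Ico_subset_Icc_self

/-- Transfers inclusions between cells to the closed cubes. -/
theorem closure_dyadicCell (m : ℕ) (k : Fin n → ℤ) :
    closure (Q.dyadicCell m k) = (Q.dyadicCube m k).toSet := by
  rw [dyadicCell_eq_pi, toSet_eq_pi, closure_pi_set]
  congr! 2 with i
  exact closure_Ico (by have := (Q.dyadicCube m k).side_pos; linarith)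

theorem interior_dyadicCube_subset (m : ℕ) (k : Fin n → ℤ) :
    interior (Q.dyadicCube m k).toSet ⊆ Q.dyadicCell m k := by
  rw [dyadicCell_eq_pi, toSet_eq_pi, interior_pi_set Set.finite_univ]
  refine Set.pi_mono fun i _ => ?_
  rw [interior_Icc]
  exact Set.Ioo_subset_Ico_self

theorem measurableSet_dyadicCell (m : ℕ) (k : Fin n → ℤ) : MeasurableSet (Q.dyadicCell m k) := by
  rw [dyadicCell_eq_pi]
  exact MeasurableSet.univ_pi fun i => measurableSet_Ico

theorem dyadicCell_ae_eq (m : ℕ) (k : Fin n → ℤ) :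
    Q.dyadicCell m k =ᵐ[volume] (Q.dyadicCube m k).toSet := by
  rw [dyadicCell_eq_pi, toSet]
  exact Measure.univ_pi_Ico_ae_eq_Icc

theorem dyadicCube_zero_zero : Q.dyadicCube 0 0 = Q := by
  cases Q
  simp [dyadicCube]

/-- Since `⌊y / N⌋ = ⌊y⌋ / N`, the index at a fine generation determines all coarser ones;
nestedness rests on this. -/
theorem dyadicIndex_eq_ediv {m m' : ℕ} (h : m' ≤ m) (x : Fin n → ℝ) (i : Fin n) :
    Q.dyadicIndex m' x i = Q.dyadicIndex m x i / ((2 ^ (m - m') : ℕ) : ℤ) := by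
  rw [dyadicIndex, dyadicIndex, ← Int.floor_div_natCast]
  congr 1
  push_cast
  rw [eq_div_iff (by positivity), mul_assoc, ← pow_add, Nat.add_sub_cancel' h]

/-- The dyadic cubes are nested. -/
theorem dyadicCell_subset_dyadicCell {m m' : ℕ} (h : m' ≤ m) (x : Fin n → ℝ) :
    Q.dyadicCell m (Q.dyadicIndex m x) ⊆ Q.dyadicCell m' (Q.dyadicIndex m' x) := by
  intro y hy
  ext i
  rw [Q.dyadicIndex_eq_ediv h, Q.dyadicIndex_eq_ediv h, show Q.dyadicIndex m y = _ from hy]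

theorem dyadicIndex_congr {m m' : ℕ} (h : m' ≤ m) {x y : Fin n → ℝ}
    (hxy : Q.dyadicIndex m y = Q.dyadicIndex m x) : Q.dyadicIndex m' y = Q.dyadicIndex m' x :=
  Q.dyadicCell_subset_dyadicCell h x hxy

/-- The closed dyadic cube of generation `m` attached to the point `x`. -/
noncomputable def dyadicCubeAt (m : ℕ) (x : Fin n → ℝ) : AxisCube n :=
  Q.dyadicCube m (Q.dyadicIndex m x)

theorem mem_dyadicCubeAt (m : ℕ) (x : Fin n → ℝ) : x ∈ (Q.dyadicCubeAt m x).toSet :=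
  Q.dyadicCell_subset_toSet m _ rfl

theorem dyadicCubeAt_subset {m m' : ℕ} (h : m' ≤ m) (x : Fin n → ℝ) :
    (Q.dyadicCubeAt m x).toSet ⊆ (Q.dyadicCubeAt m' x).toSet := by
  rw [dyadicCubeAt, dyadicCubeAt, ← closure_dyadicCell, ← closure_dyadicCell]
  exact closure_mono (Q.dyadicCell_subset_dyadicCell h x)

theorem volume_dyadicCubeAt_pred (m : ℕ) (x : Fin n → ℝ) :
    volume (Q.dyadicCubeAt m x).toSet = 2 ^ n * volume (Q.dyadicCubeAt (m + 1) x).toSet := by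
  rw [volume_toSet, volume_toSet, show (2 : ℝ≥0∞) = ENNReal.ofReal 2 by simp,
    ← ENNReal.ofReal_pow (by norm_num), ← ENNReal.ofReal_mul (by positivity), ← mul_pow]
  congr 2
  simp only [dyadicCubeAt, dyadicCube, pow_succ]
  field_simp

/-- The metric on `Fin n → ℝ` is the sup metric, so differentiation theorems for balls apply to
cubes. -/
theorem toSet_eq_closedBall :
    Q.toSet = Metric.closedBall (fun i => Q.corner i + Q.side / 2) (Q.side / 2) := by
  have := Q.side_pos
  rw [toSet_eq_pi, closedBall_pi _ (by positivity)]
  congr! 2 with i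
  rw [Real.closedBall_eq_Icc]
  congr 1 <;> ring

/-- The mean value of `|g|` over a cube. -/
noncomputable def meanNorm (g : (Fin n → ℝ) → ℝ) : ℝ≥0∞ :=
  (∫⁻ x in Q.toSet, ‖g x‖ₑ) / volume Q.toSet

theorem lintegral_le_of_meanNorm_le {g : (Fin n → ℝ) → ℝ} {s : ℝ≥0∞} (h : Q.meanNorm g ≤ s) :
    ∫⁻ x in Q.toSet, ‖g x‖ₑ ≤ s * volume Q.toSet :=
  (ENNReal.div_le_iff Q.volume_toSet_ne_zero Q.volume_toSet_ne_top).1 h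

theorem lt_lintegral_of_lt_meanNorm {g : (Fin n → ℝ) → ℝ} {s : ℝ≥0∞} (h : s < Q.meanNorm g) :
    s * volume Q.toSet < ∫⁻ x in Q.toSet, ‖g x‖ₑ :=
  (ENNReal.lt_div_iff_mul_lt (.inl Q.volume_toSet_ne_zero) (.inl Q.volume_toSet_ne_top)).1 h

open Filter Topology in
/-- Lebesgue's differentiation theorem along dyadic cubes. -/
theorem ae_tendsto_meanNorm_dyadicCubeAt {g : (Fin n → ℝ) → ℝ} (hg : IntegrableOn g Q.toSet) :
    ∀ᵐ x, x ∈ Q.dyadicCell 0 0 →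
      Tendsto (fun m => (Q.dyadicCubeAt m x).meanNorm g) atTop (𝓝 ‖g x‖ₑ) := by
  set F : (Fin n → ℝ) → ℝ≥0∞ := Q.toSet.indicator fun x => ‖g x‖ₑ
  have hF : AEMeasurable F volume :=
    (aemeasurable_indicator_iff Q.measurableSet_toSet).2 hg.aestronglyMeasurable.enorm
  have hFi : ∫⁻ x, F x ≠ ∞ := by
    rw [lintegral_indicator Q.measurableSet_toSet]
    exact hg.hasFiniteIntegral.ne
  -- The parameter `1` admits balls that contain `x` without being centred there, as dyadic cubes
  -- do.
  filter_upwards [(IsUnifLocDoublingMeasure.vitaliFamily (volume : Measure (Fin n → ℝ))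
    1).ae_tendsto_lintegral_div hF hFi] with x hx hxQ
  have hδ : Tendsto (fun m => (Q.dyadicCubeAt m x).side / 2) atTop (𝓝[>] 0) := by
    refine tendsto_nhdsWithin_iff.2 ⟨?_, Eventually.of_forall fun m =>
      half_pos (Q.dyadicCubeAt m x).side_pos⟩
    have : Tendsto (fun m : ℕ => Q.side / 2 * (1 / 2 : ℝ) ^ m) atTop (𝓝 (Q.side / 2 * 0)) :=
      (tendsto_pow_atTop_nhds_zero_of_lt_one (by norm_num) (by norm_num)).const_mul _
    rw [mul_zero] at this
    refine this.congr fun m => ?_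
    simp only [dyadicCubeAt, dyadicCube, one_div, inv_pow]
    ring
  have h0 : ∀ m, (Q.dyadicCubeAt m x).toSet ⊆ Q.toSet := fun m => by
    have := Q.dyadicCubeAt_subset (Nat.zero_le m) x
    rwa [dyadicCubeAt.eq_1 Q 0, show Q.dyadicIndex 0 x = 0 from hxQ, dyadicCube_zero_zero] at this
  have := hx.comp (IsUnifLocDoublingMeasure.tendsto_closedBall_filterAt volume
    (fun m i => (Q.dyadicCubeAt m x).corner i + (Q.dyadicCubeAt m x).side / 2) _ hδ
    (Eventually.of_forall fun m => by
      rw [one_mul, ← toSet_eq_closedBall]; exact Q.mem_dyadicCubeAt m x))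
  have hFx : F x = ‖g x‖ₑ := Set.indicator_of_mem (h0 0 (Q.mem_dyadicCubeAt 0 x)) _
  rw [hFx] at this
  refine this.congr fun m => ?_
  simp only [Function.comp_apply, ← toSet_eq_closedBall, meanNorm]
  congr 1
  exact setLIntegral_congr_fun (measurableSet_toSet _) fun y hy =>
    Set.indicator_of_mem (h0 m hy) _

/-! ### Calderón-Zygmund stopping cubes. -/

/-- `m` is the first generation at which the mean of `|g|` over the dyadic cube at `x`
exceeds `s`. -/
noncomputable def IsStoppingTime (g : (Fin n → ℝ) → ℝ) (s : ℝ≥0∞) (x : Fin n → ℝ) (m : ℕ) : Prop :=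
  s < (Q.dyadicCubeAt m x).meanNorm g ∧ ∀ m' < m, (Q.dyadicCubeAt m' x).meanNorm g ≤ s

/-- The Calderón-Zygmund family of `g` at height `s`: the (generations and indices of the) maximal
dyadic subcubes of `Q` on which the mean of `|g|` exceeds `s`. -/
noncomputable def stoppingFamily (g : (Fin n → ℝ) → ℝ) (s : ℝ≥0∞) : Set (ℕ × (Fin n → ℤ)) :=
  {q | ∃ x, Q.dyadicIndex 0 x = 0 ∧ Q.dyadicIndex q.1 x = q.2 ∧ Q.IsStoppingTime g s x q.1}

variable {Q} {g : (Fin n → ℝ) → ℝ} {s : ℝ≥0∞}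

/-- Stopping at generation `m` involves only cubes of generation at most `m`, all determined by the
index at `m`. -/
theorem IsStoppingTime.congr {x y : Fin n → ℝ} {m : ℕ} (h : Q.IsStoppingTime g s x m)
    (hxy : Q.dyadicIndex m y = Q.dyadicIndex m x) : Q.IsStoppingTime g s y m := by
  have hcube : ∀ m' ≤ m, Q.dyadicCubeAt m' y = Q.dyadicCubeAt m' x := fun m' hm' => by
    rw [dyadicCubeAt, dyadicCubeAt, Q.dyadicIndex_congr hm' hxy]
  refine ⟨?_, fun m' hm' => ?_⟩
  · rw [hcube m le_rfl]; exact h.1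
  · rw [hcube m' hm'.le]; exact h.2 m' hm'

theorem IsStoppingTime.unique {x : Fin n → ℝ} {m m' : ℕ} (h : Q.IsStoppingTime g s x m)
    (h' : Q.IsStoppingTime g s x m') : m = m' := by
  rcases lt_trichotomy m m' with hlt | heq | hlt
  · exact absurd h.1 (h'.2 m hlt).not_gt
  · exact heq
  · exact absurd h'.1 (h.2 m' hlt).not_gt

theorem exists_isStoppingTime {x : Fin n → ℝ} {m : ℕ} (h : s < (Q.dyadicCubeAt m x).meanNorm g) :
    ∃ m' ≤ m, Q.IsStoppingTime g s x m' := by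
  classical
  have hex : ∃ m, s < (Q.dyadicCubeAt m x).meanNorm g := ⟨m, h⟩
  exact ⟨Nat.find hex, Nat.find_min' hex h, Nat.find_spec hex,
    fun m' hm' => not_lt.1 (Nat.find_min hex hm')⟩

theorem isStoppingTime_of_mem {q : ℕ × (Fin n → ℤ)} (hq : q ∈ Q.stoppingFamily g s)
    {y : Fin n → ℝ} (hy : y ∈ Q.dyadicCell q.1 q.2) :
    y ∈ Q.dyadicCell 0 0 ∧ Q.IsStoppingTime g s y q.1 := by
  obtain ⟨x, hx0, hxq, hx⟩ := hq
  have hxy : Q.dyadicIndex q.1 y = Q.dyadicIndex q.1 x := hxq ▸ hy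
  exact ⟨(Q.dyadicIndex_congr (Nat.zero_le _) hxy).trans hx0, hx.congr hxy⟩

theorem pairwiseDisjoint_stoppingFamily :
    (Q.stoppingFamily g s).PairwiseDisjoint fun q => Q.dyadicCell q.1 q.2 := by
  intro q hq r hr hne
  refine Set.disjoint_left.2 fun y hyq hyr => hne ?_
  have h1 := (isStoppingTime_of_mem hq hyq).2.unique (isStoppingTime_of_mem hr hyr).2
  refine Prod.ext h1 ?_
  rw [← show Q.dyadicIndex q.1 y = q.2 from hyq, ← show Q.dyadicIndex r.1 y = r.2 from hyr, h1]

theorem dyadicCell_zero_ae_eq : Q.dyadicCell 0 0 =ᵐ[volume] Q.toSet := by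
  simpa [dyadicCube_zero_zero] using Q.dyadicCell_ae_eq 0 0

theorem dyadicCube_subset_of_mem {q : ℕ × (Fin n → ℤ)} (hq : q ∈ Q.stoppingFamily g s) :
    (Q.dyadicCube q.1 q.2).toSet ⊆ Q.toSet := by
  rw [← closure_dyadicCell]
  calc _ ⊆ closure (Q.dyadicCell 0 0) := closure_mono fun y hy => (isStoppingTime_of_mem hq hy).1
    _ = _ := by rw [closure_dyadicCell, dyadicCube_zero_zero]

/-- The side recovers the generation and the corner the index. A packing is a set of cubes, so this
is needed to rewrite its sums over index pairs. -/
theorem injOn_dyadicCube : Set.InjOn (fun q : ℕ × (Fin n → ℤ) => Q.dyadicCube q.1 q.2)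
    (Q.stoppingFamily g s) := by
  rintro ⟨m, k⟩ - ⟨m', k'⟩ - h
  have hside := congrArg AxisCube.side h
  have := Q.side_pos
  simp only [dyadicCube] at hside
  field_simp at hside
  obtain rfl : m = m' :=
    Nat.pow_right_injective (le_refl 2) (by exact_mod_cast hside.symm)
  refine Prod.ext rfl (funext fun i => ?_)
  have hc := congrArg (fun R : AxisCube n => R.corner i) h
  simp only [dyadicCube, add_right_inj] at hc
  field_simp at hc
  exact_mod_cast hc

/-- The Calderón-Zygmund cubes form a packing. -/
theorem isPacking_stoppingFamily :
    IsPacking Q ((fun q : ℕ × (Fin n → ℤ) => Q.dyadicCube q.1 q.2) '' Q.stoppingFamily g s) := by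
  refine ⟨(Set.to_countable _).image _, ?_, ?_⟩
  · rintro _ ⟨q, hq, rfl⟩
    exact dyadicCube_subset_of_mem hq
  · rintro _ ⟨q, hq, rfl⟩ _ ⟨r, hr, rfl⟩ hne
    exact (pairwiseDisjoint_stoppingFamily hq hr fun h => hne (h ▸ rfl)).mono
      (Q.interior_dyadicCube_subset _ _) (Q.interior_dyadicCube_subset _ _)

/-- The total volume of the Calderón-Zygmund cubes of `g` at height `s`. -/
noncomputable def stoppingVolume (Q : AxisCube n) (g : (Fin n → ℝ) → ℝ) (s : ℝ≥0∞) : ℝ≥0∞ :=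
  ∑' q : Q.stoppingFamily g s, volume (Q.dyadicCube q.1.1 q.1.2).toSet

theorem stoppingVolume_eq :
    Q.stoppingVolume g s = volume (⋃ q ∈ Q.stoppingFamily g s, Q.dyadicCell q.1 q.2) := by
  rw [measure_biUnion (Set.to_countable _) pairwiseDisjoint_stoppingFamily
    fun q _ => Q.measurableSet_dyadicCell _ _]
  exact tsum_congr fun q => (measure_congr (Q.dyadicCell_ae_eq _ _)).symm

theorem stoppingVolume_le : Q.stoppingVolume g s ≤ volume Q.toSet := by
  rw [stoppingVolume_eq]
  exact measure_mono (Set.iUnion₂_subset fun q hq =>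
    (Q.dyadicCell_subset_toSet _ _).trans (dyadicCube_subset_of_mem hq))

/-- Almost every point where `|g| > s` lies in a Calderón-Zygmund cube. -/
theorem volume_lt_enorm_le_stoppingVolume (hg : IntegrableOn g Q.toSet) :
    volume {x | x ∈ Q.toSet ∧ s < ‖g x‖ₑ} ≤ Q.stoppingVolume g s := by
  rw [stoppingVolume_eq]
  refine measure_mono_ae ?_
  filter_upwards [Q.ae_tendsto_meanNorm_dyadicCubeAt hg, (dyadicCell_zero_ae_eq (Q := Q)).mem_iff]
    with x hx hx0 hxs
  have hxQ := hx0.2 hxs.1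
  obtain ⟨m, hm⟩ := ((hx hxQ).eventually (lt_mem_nhds hxs.2)).exists
  obtain ⟨m', -, hm'⟩ := exists_isStoppingTime hm
  exact Set.mem_biUnion (x := (m', Q.dyadicIndex m' x)) ⟨x, hxQ, rfl, hm'⟩ rfl

end AxisCube

/-! ### Decay of the stopping volume. -/

namespace AxisCube

variable {Q : AxisCube n} {g : (Fin n → ℝ) → ℝ} {s : ℝ≥0∞}

/-- The mean of `|g|` over a Calderón-Zygmund cube is comparable to the height. -/
theorem meanNorm_le_of_mem (hQ : Q.meanNorm g ≤ s) {q : ℕ × (Fin n → ℤ)}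
    (hq : q ∈ Q.stoppingFamily g s) : (Q.dyadicCube q.1 q.2).meanNorm g ≤ 2 ^ n * s := by
  obtain ⟨x, hx0, hxq, hx⟩ := hq
  rw [← hxq, ← dyadicCubeAt]
  obtain ⟨m, k⟩ := q
  cases m with
  | zero =>
    -- Stopping at generation `0` is excluded because the mean over `Q` is at most `s`; otherwise
    -- the parent cube was not selected.
    refine absurd hx.1 (not_lt.2 ?_)
    rwa [dyadicCubeAt, hx0, dyadicCube_zero_zero]
  | succ m =>
    refine (ENNReal.div_le_iff (volume_toSet_ne_zero _) (volume_toSet_ne_top _)).2 ?_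
    calc _ ≤ ∫⁻ x in (Q.dyadicCubeAt m x).toSet, ‖g x‖ₑ :=
          lintegral_mono_set (Q.dyadicCubeAt_subset (Nat.le_succ m) x)
      _ ≤ s * volume (Q.dyadicCubeAt m x).toSet :=
          lintegral_le_of_meanNorm_le _ (hx.2 m (Nat.lt_succ_self m))
      _ = _ := by rw [volume_dyadicCubeAt_pred]; ring

/-- The mean over `Q` of `|g - g y|`. -/
noncomputable def meanDeviation (Q : AxisCube n) (g : (Fin n → ℝ) → ℝ) (y : Fin n → ℝ) : ℝ≥0∞ :=
  (volume Q.toSet)⁻¹ * ∫⁻ x in Q.toSet, ‖g x - g y‖ₑ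

theorem lintegral_meanDeviation (Q : AxisCube n) (g : (Fin n → ℝ) → ℝ) :
    ∫⁻ y in Q.toSet, Q.meanDeviation g y =
      (volume Q.toSet)⁻¹ * ∫⁻ y in Q.toSet, ∫⁻ x in Q.toSet, ‖g x - g y‖ₑ :=
  lintegral_const_mul' _ _ (ENNReal.inv_ne_top.2 Q.volume_toSet_ne_zero)

/-- Average `|g y| ≤ |g x - g y| + |g x|` over `x`. -/
theorem enorm_le_meanDeviation_add (hg : AEMeasurable g (volume.restrict Q.toSet))
    (y : Fin n → ℝ) : ‖g y‖ₑ ≤ Q.meanDeviation g y + Q.meanNorm g := by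
  have h : ‖g y‖ₑ * volume Q.toSet ≤
      (∫⁻ x in Q.toSet, ‖g x - g y‖ₑ) + ∫⁻ x in Q.toSet, ‖g x‖ₑ := by
    rw [← setLIntegral_const, ← lintegral_add_right' _ hg.enorm]
    refine lintegral_mono fun x => ?_
    calc ‖g y‖ₑ = ‖(g y - g x) + g x‖ₑ := by rw [sub_add_cancel]
      _ ≤ ‖g y - g x‖ₑ + ‖g x‖ₑ := enorm_add_le _ _
      _ = _ := by rw [enorm_sub_rev]
  rw [meanDeviation, meanNorm, mul_comm, ← div_eq_mul_inv, ← ENNReal.add_div]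
  exact (ENNReal.le_div_iff_mul_le (.inl Q.volume_toSet_ne_zero) (.inl Q.volume_toSet_ne_top)).2 h

/-- Every Calderón-Zygmund cube at a larger height lies in one at a smaller height. -/
theorem exists_dyadicCell_subset {t : ℝ≥0∞} (hst : s ≤ t) {r : ℕ × (Fin n → ℤ)}
    (hr : r ∈ Q.stoppingFamily g t) :
    ∃ q ∈ Q.stoppingFamily g s, Q.dyadicCell r.1 r.2 ⊆ Q.dyadicCell q.1 q.2 := by
  obtain ⟨x, hx0, hxr, hx⟩ := hr
  obtain ⟨m, hm, hτ⟩ := exists_isStoppingTime (hst.trans_lt hx.1)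
  refine ⟨(m, Q.dyadicIndex m x), ⟨x, hx0, rfl, hτ⟩, ?_⟩
  rw [← hxr]
  exact Q.dyadicCell_subset_dyadicCell hm x

/-- The mean of `|g|` exceeds `2 ^ (n + 1) * s` on `r` and is at most `2 ^ n * s` on `q`; the gap `2
^ n * s` must come from the deviation. -/
theorem volume_stopping_le_lintegral_meanDeviation (hg : AEMeasurable g (volume.restrict Q.toSet))
    (hQ : Q.meanNorm g ≤ s) (hs : s ≠ ∞) {q r : ℕ × (Fin n → ℤ)}
    (hr : r ∈ Q.stoppingFamily g (2 ^ (n + 1) * s)) (hq : q ∈ Q.stoppingFamily g s) :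
    2 ^ n * s * volume (Q.dyadicCube r.1 r.2).toSet ≤
      ∫⁻ y in Q.dyadicCell r.1 r.2, (Q.dyadicCube q.1 q.2).meanDeviation g y := by
  have hlow : 2 ^ (n + 1) * s * volume (Q.dyadicCube r.1 r.2).toSet ≤
      ∫⁻ y in Q.dyadicCell r.1 r.2, ‖g y‖ₑ := by
    rw [setLIntegral_congr (Q.dyadicCell_ae_eq _ _)]
    obtain ⟨x, -, hxr, hx⟩ := hr
    rw [← hxr]
    exact (lt_lintegral_of_lt_meanNorm _ hx.1).le
  have hup : ∫⁻ y in Q.dyadicCell r.1 r.2, ‖g y‖ₑ ≤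
      (∫⁻ y in Q.dyadicCell r.1 r.2, (Q.dyadicCube q.1 q.2).meanDeviation g y) +
        2 ^ n * s * volume (Q.dyadicCube r.1 r.2).toSet := by
    calc _ ≤ ∫⁻ y in Q.dyadicCell r.1 r.2,
          ((Q.dyadicCube q.1 q.2).meanDeviation g y + 2 ^ n * s) := by
          refine lintegral_mono fun y => (enorm_le_meanDeviation_add (hg.mono_measure
            (Measure.restrict_mono (dyadicCube_subset_of_mem hq) le_rfl)) y).trans ?_
          gcongr
          exact meanNorm_le_of_mem hQ hq
      _ = _ := by
          rw [lintegral_add_right _ measurable_const, setLIntegral_const,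
            measure_congr (Q.dyadicCell_ae_eq _ _)]
  have hfin : 2 ^ n * s * volume (Q.dyadicCube r.1 r.2).toSet ≠ ∞ :=
    ENNReal.mul_ne_top (ENNReal.mul_ne_top (by finiteness) hs) (volume_toSet_ne_top _)
  refine (ENNReal.add_le_add_iff_right hfin).1 (le_trans (le_of_eq ?_) (hlow.trans hup))
  ring

/-- The Garsia-Rodemich condition makes the Calderón-Zygmund cubes decay. -/
theorem stoppingVolume_decay {p : ℝ} {C : ℝ≥0} (hC : GaRoCondition p Q g C)
    (hg : AEMeasurable g (volume.restrict Q.toSet)) (hQ : Q.meanNorm g ≤ s) (hs : s ≠ ∞) :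
    2 ^ n * s * Q.stoppingVolume g (2 ^ (n + 1) * s) ≤ C * Q.stoppingVolume g s ^ (1 - 1 / p) := by
  have hst : s ≤ 2 ^ (n + 1) * s :=
    le_mul_of_one_le_left' (one_le_pow₀ one_le_two)
  choose! par hpar hsub using fun r (hr : r ∈ Q.stoppingFamily g (2 ^ (n + 1) * s)) =>
    exists_dyadicCell_subset hst hr
  let π : Q.stoppingFamily g (2 ^ (n + 1) * s) → Q.stoppingFamily g s :=
    fun r => ⟨par r, hpar r r.2⟩
  have hpack := hC _ (isPacking_stoppingFamily (Q := Q) (g := g) (s := s))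
  rw [tsum_image (fun R : AxisCube n => (volume R.toSet)⁻¹ *
      ∫⁻ y in R.toSet, ∫⁻ x in R.toSet, ‖g x - g y‖ₑ) injOn_dyadicCube,
    tsum_image (fun R : AxisCube n => volume R.toSet) injOn_dyadicCube] at hpack
  refine le_trans ?_ hpack
  simp_rw [← lintegral_meanDeviation]
  rw [stoppingVolume, ← ENNReal.tsum_mul_left]
  calc _ ≤ ∑' r : Q.stoppingFamily g (2 ^ (n + 1) * s),
          ∫⁻ y in Q.dyadicCell r.1.1 r.1.2,
          (Q.dyadicCube (π r).1.1 (π r).1.2).meanDeviation g y :=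
        ENNReal.tsum_le_tsum fun r =>
          volume_stopping_le_lintegral_meanDeviation hg hQ hs r.2 (π r).2
    -- Group the small cells by the chosen larger cube; those in one group are disjoint and lie
    -- inside it.
    _ = ∑' q, ∑' r : {r // π r = q}, ∫⁻ y in Q.dyadicCell r.1.1.1 r.1.1.2,
          (Q.dyadicCube q.1.1 q.1.2).meanDeviation g y := by
        rw [← (Equiv.sigmaFiberEquiv π).tsum_eq, ENNReal.tsum_sigma']
        refine tsum_congr fun q => tsum_congr fun r => ?_
        simp only [Equiv.sigmaFiberEquiv_apply, r.2]
    _ ≤ _ := by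
        refine ENNReal.tsum_le_tsum fun q => ?_
        rw [← lintegral_iUnion (fun r => Q.measurableSet_dyadicCell _ _)]
        · refine lintegral_mono_set (Set.iUnion_subset fun r => ?_)
          have h1 := hsub r.1 r.1.2
          rw [show par r.1 = q.1 from congrArg Subtype.val r.2] at h1
          exact h1.trans (Q.dyadicCell_subset_toSet _ _)
        · intro r r' hne
          exact pairwiseDisjoint_stoppingFamily r.1.2 r'.1.2
            fun h => hne (Subtype.ext (Subtype.ext h))

/-- The iterated form of the decay estimate. -/
theorem stoppingVolume_le_rpow {p : ℝ} (hp : 1 < p) {C : ℝ≥0} (hC0 : 0 < C)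
    (hC : GaRoCondition p Q g C) (hg : AEMeasurable g (volume.restrict Q.toSet)) {s₀ : ℝ}
    (hs₀ : 0 < s₀) (hQ : Q.meanNorm g ≤ ENNReal.ofReal s₀)
    (hvol : volume Q.toSet ≤ ENNReal.ofReal ((C / s₀) ^ p)) (k : ℕ) :
    ∀ s : ℝ, s₀ ≤ s → s ≤ (2 ^ (n + 1)) ^ (k + 1) * s₀ →
      Q.stoppingVolume g (ENNReal.ofReal s) ≤
        ENNReal.ofReal ((((2 : ℝ) ^ (n + 1)) ^ p * C / s) ^ p) := by
  have hp0 : 0 < p := by linarith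
  have hCR : (0 : ℝ) < C := by exact_mod_cast hC0
  set L : ℝ := 2 ^ (n + 1) with hL
  have hL1 : 1 ≤ L := one_le_pow₀ one_le_two
  have hL0 : 0 < L := by positivity
  have hLp : L ≤ L ^ p := by simpa using Real.rpow_le_rpow_of_exponent_le hL1 hp.le
  -- For `s ≤ L * s₀` the bound by `|Q|` suffices, because `L ≤ L ^ p`.
  have base : ∀ s : ℝ, s₀ ≤ s → s ≤ L * s₀ → Q.stoppingVolume g (ENNReal.ofReal s) ≤
        ENNReal.ofReal ((L ^ p * C / s) ^ p) := fun s hs hsL => by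
    have hs0 : 0 < s := hs₀.trans_le hs
    refine stoppingVolume_le.trans (hvol.trans (ENNReal.ofReal_le_ofReal ?_))
    refine Real.rpow_le_rpow (by positivity) ?_ hp0.le
    rw [div_le_div_iff₀ hs₀ hs0]
    calc C * s ≤ C * (L ^ p * s₀) := by
          gcongr; exact hsL.trans (by gcongr)
      _ = _ := by ring
  induction k with
  | zero => simpa using base
  | succ k ih =>
    intro s hs hsk
    rcases le_total s (L * s₀) with h | h
    · exact base s hs h
    obtain ⟨t, rfl⟩ : ∃ t, s = L * t := ⟨s / L, by field_simp⟩
    have ht : s₀ ≤ t := le_of_mul_le_mul_left h hL0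
    have ht0 : 0 < t := hs₀.trans_le ht
    have htk : t ≤ L ^ (k + 1) * s₀ := by
      refine le_of_mul_le_mul_left (hsk.trans_eq ?_) hL0
      rw [pow_succ L (k + 1)]; ring
    have hdec := stoppingVolume_decay hC hg (hQ.trans (ENNReal.ofReal_le_ofReal ht))
      ENNReal.ofReal_ne_top
    have hLe : (2 : ℝ≥0∞) ^ (n + 1) * ENNReal.ofReal t = ENNReal.ofReal (L * t) := by
      rw [ENNReal.ofReal_mul hL0.le, hL, ENNReal.ofReal_pow (by norm_num)]; simp
    have h2e : (2 : ℝ≥0∞) ^ n * ENNReal.ofReal t = ENNReal.ofReal (2 ^ n * t) := by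
      rw [ENNReal.ofReal_mul (by positivity), ENNReal.ofReal_pow (by norm_num)]; simp
    rw [hLe, h2e] at hdec
    have hexp : 0 ≤ 1 - 1 / p := by
      rw [sub_nonneg, div_le_one hp0]; exact hp.le
    have hd2 := hdec.trans (mul_le_mul_right (ENNReal.rpow_le_rpow (ih t ht htk) hexp) (C : ℝ≥0∞))
    set a : ℝ := L ^ p * C / t with ha
    have ha0 : 0 < a := by positivity
    rw [ENNReal.ofReal_rpow_of_pos (by positivity), ← ENNReal.ofReal_coe_nnreal,
      ← ENNReal.ofReal_mul C.coe_nonneg, mul_comm (ENNReal.ofReal _),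
      ← ENNReal.le_div_iff_mul_le (.inl (by
        simp only [ne_eq, ENNReal.ofReal_eq_zero, not_le]; positivity))
        (.inl ENNReal.ofReal_ne_top), ← ENNReal.ofReal_div_of_pos (by positivity)] at hd2
    refine hd2.trans (ENNReal.ofReal_le_ofReal ?_)
    have e1 : (a ^ p) ^ (1 - 1 / p) = a ^ p / a := by
      rw [← Real.rpow_mul ha0.le, mul_sub, mul_one_div_cancel hp0.ne', mul_one,
        Real.rpow_sub_one ha0.ne']
    have e2 : L ^ p * C / (L * t) = a / L := by rw [ha]; field_simp
    rw [e1, e2, Real.div_rpow ha0.le hL0.le, div_le_div_iff₀ (by positivity) (by positivity)]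
    -- This closes the induction: passing from `t` to `L * t` costs `L ^ p`, which the constant `L ^
    -- p * C` absorbs, with a factor `2 ^ n` to spare.
    have e3 : a * t = L ^ p * C := by rw [ha]; field_simp
    calc C * (a ^ p / a) * L ^ p = (a ^ p / a) * (a * t) := by rw [e3]; ring
      _ = a ^ p * t := by field_simp
      _ ≤ a ^ p * (2 ^ n * t) := by
        gcongr
        exact le_mul_of_one_le_left ht0.le (one_le_pow₀ one_le_two)

end AxisCube

/-! ### From the Garsia-Rodemich space to weak `L^p`. -/

/-- A function with vanishing mean is controlled by its mean oscillation. -/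
theorem lintegral_enorm_subMean_le (Q : AxisCube n) {f : (Fin n → ℝ) → ℝ}
    (hf : IntegrableOn f Q.toSet) :
    ∫⁻ y in Q.toSet, ‖subMean Q f y‖ₑ ≤ (volume Q.toSet)⁻¹ *
      ∫⁻ y in Q.toSet, ∫⁻ x in Q.toSet, ‖subMean Q f x - subMean Q f y‖ₑ := by
  rw [← AxisCube.lintegral_meanDeviation]
  refine lintegral_mono fun y => ?_
  have hfin : IsFiniteMeasure (volume.restrict Q.toSet) :=
    ⟨by simpa using Q.volume_toSet_ne_top.lt_top⟩
  have hV := Q.volume_toSet_ne_top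
  have hV0 := Q.volume_toSet_ne_zero
  have h1 : ∫ x in Q.toSet, (f y - f x) = volume.real Q.toSet * subMean Q f y := by
    have hr : volume.real Q.toSet ≠ 0 := (ENNReal.toReal_pos hV0 hV).ne'
    rw [integral_sub (integrable_const _) hf, setIntegral_const, subMean, setAverage_eq,
      smul_eq_mul, smul_eq_mul]
    field_simp
  have h2 := enorm_integral_le_lintegral_enorm (μ := volume.restrict Q.toSet) fun x => f y - f x
  rw [h1, enorm_mul, Measure.real, Real.enorm_of_nonneg ENNReal.toReal_nonneg,
    ENNReal.ofReal_toReal hV] at h2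
  rw [AxisCube.meanDeviation, mul_comm, ← div_eq_mul_inv]
  refine (ENNReal.le_div_iff_mul_le (.inl hV0) (.inl hV)).2 ?_
  rw [mul_comm]
  refine h2.trans_eq (lintegral_congr fun x => ?_)
  rw [enorm_sub_rev, subMean, subMean, sub_sub_sub_cancel_right]

/-- The embedding of the Garsia-Rodemich space into weak `L^p`. -/
theorem weakLpNorm_subMean_le {p : ℝ} (hp : 1 < p) {Q : AxisCube n} {f : (Fin n → ℝ) → ℝ}
    (hf : IntegrableOn f Q.toSet) {C : ℝ≥0} (hC0 : 0 < C)
    (hC : GaRoCondition p Q (subMean Q f) C) :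
    weakLpNorm p Q (subMean Q f) ≤ ENNReal.ofReal (((2 : ℝ) ^ (n + 1)) ^ p) * C := by
  have hp0 : 0 < p := by linarith
  have hCR : (0 : ℝ) < C := by exact_mod_cast hC0
  have hfin : IsFiniteMeasure (volume.restrict Q.toSet) :=
    ⟨by simpa using Q.volume_toSet_ne_top.lt_top⟩
  have hg : IntegrableOn (subMean Q f) Q.toSet := Integrable.sub hf (integrable_const _)
  set g := subMean Q f with hgdef
  set L : ℝ := 2 ^ (n + 1) with hL
  have hL1 : 1 < L := one_lt_pow₀ one_lt_two (Nat.succ_ne_zero n)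
  have hL0 : 0 < L := by linarith
  set V : ℝ := Q.side ^ n with hV
  have hV0 : 0 < V := pow_pos Q.side_pos n
  have hVe : volume Q.toSet = ENNReal.ofReal V := Q.volume_toSet
  -- The one-cube packing gives `∫ |g| ≤ C * V ^ (1 - 1 / p) = s₀ * V`, so the mean of `|g|` over
  -- `Q` is at most `s₀`; also `(C / s₀) ^ p = V`, which starts the iteration.
  set s₀ : ℝ := C * V ^ (-(1 / p)) with hs₀
  have hs₀pos : 0 < s₀ := by positivity
  have hCs₀ : (C / s₀) ^ p = V := by
    rw [hs₀, Real.rpow_neg hV0.le, div_mul_eq_div_div, div_self hCR.ne', one_div, inv_inv,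
      ← Real.rpow_mul hV0.le, one_div_mul_cancel hp0.ne', Real.rpow_one]
  have hmean : Q.meanNorm g ≤ ENNReal.ofReal s₀ := by
    refine (ENNReal.div_le_iff Q.volume_toSet_ne_zero Q.volume_toSet_ne_top).2 ?_
    have hone : IsPacking Q {Q} :=
      ⟨Set.countable_singleton _, by simp, Set.pairwiseDisjoint_singleton _ _⟩
    have := hC _ hone
    rw [tsum_singleton Q (fun R : AxisCube n => (volume R.toSet)⁻¹ *
      ∫⁻ y in R.toSet, ∫⁻ x in R.toSet, ‖g x - g y‖ₑ),
      tsum_singleton Q (fun R : AxisCube n => volume R.toSet)] at this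
    refine (lintegral_enorm_subMean_le Q hf).trans (this.trans_eq ?_)
    rw [hVe, ENNReal.ofReal_rpow_of_pos hV0, ← ENNReal.ofReal_coe_nnreal,
      ← ENNReal.ofReal_mul hCR.le, ← ENNReal.ofReal_mul hs₀pos.le]
    congr 1
    rw [hs₀, sub_eq_add_neg, Real.rpow_add hV0, Real.rpow_one]
    ring
  have hdist : ∀ s : ℝ, 0 < s → volume {x | x ∈ Q.toSet ∧ ENNReal.ofReal s < ‖g x‖ₑ} ≤
      ENNReal.ofReal ((L ^ p * C / s) ^ p) := fun s hs => by
    rcases le_total s s₀ with h | h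
    · calc _ ≤ volume Q.toSet := measure_mono fun x hx => hx.1
        _ = ENNReal.ofReal ((C / s₀) ^ p) := by rw [hVe, hCs₀]
        _ ≤ _ := by
          refine ENNReal.ofReal_le_ofReal (Real.rpow_le_rpow (by positivity) ?_ hp0.le)
          gcongr
          exact le_mul_of_one_le_left hCR.le (Real.one_le_rpow hL1.le hp0.le)
    · obtain ⟨k, hk⟩ := pow_unbounded_of_one_lt (s / s₀) hL1
      refine (AxisCube.volume_lt_enorm_le_stoppingVolume hg).trans
        (AxisCube.stoppingVolume_le_rpow hp hC0 hC hg.aestronglyMeasurable.aemeasurable hs₀pos hmean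
          (by rw [hVe, hCs₀]) k s h ?_)
      rw [← div_le_iff₀ hs₀pos]
      exact hk.le.trans (pow_le_pow_right₀ hL1.le (Nat.le_succ k))
  refine iSup₂_le fun t ht => ?_
  have htR : (0 : ℝ) < t := by exact_mod_cast ht
  -- The height at which the distribution bound equals `t`.
  set s : ℝ := L ^ p * C * (t : ℝ) ^ (-(1 / p)) with hs
  have hs0 : 0 < s := by positivity
  have hst : (L ^ p * C / s) ^ p = t := by
    rw [hs, Real.rpow_neg htR.le, div_mul_eq_div_div, div_self (by positivity), one_div, inv_inv,
      ← Real.rpow_mul htR.le, one_div_mul_cancel hp0.ne', Real.rpow_one]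
  have hr : rearrangement Q g t ≤ ENNReal.ofReal s := by
    refine sInf_le ((hdist s hs0).trans_eq ?_)
    rw [hst, ENNReal.ofReal_coe_nnreal]
  calc _ ≤ (t : ℝ≥0∞) ^ (1 / p) * ENNReal.ofReal s := by gcongr
    _ = _ := by
      rw [← ENNReal.ofReal_coe_nnreal (p := t), ENNReal.ofReal_rpow_of_pos htR,
        ← ENNReal.ofReal_mul (by positivity), ← ENNReal.ofReal_coe_nnreal (p := C),
        ← ENNReal.ofReal_mul (by positivity), hs, Real.rpow_neg htR.le]
      congr 1
      field_simp

theorem mainTheorem2 (n : ℕ) (hn : 1 ≤ n) (p : ℝ) (hp : 1 < p) :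
    (∀ (Q₀ : AxisCube n) (f : (Fin n → ℝ) → ℝ), IntegrableOn f Q₀.toSet volume →
      gaRoNorm p Q₀ (subMean Q₀ f)
        ≤ ENNReal.ofReal (2 * p / (p - 1)) * weakLpNorm p Q₀ (subMean Q₀ f)) ∧
    (∃ c : ℝ≥0, 0 < c ∧
      ∀ (Q₀ : AxisCube n) (f : (Fin n → ℝ) → ℝ), IntegrableOn f Q₀.toSet volume →
        weakLpNorm p Q₀ (subMean Q₀ f) ≤ (c : ℝ≥0∞) * gaRoNorm p Q₀ (subMean Q₀ f)) := by
  have hc : (0 : ℝ) < ((2 : ℝ) ^ (n + 1)) ^ p := by positivity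
  refine ⟨fun Q₀ f hf => gaRoNorm_le_weakLpNorm hp ?_,
    Real.toNNReal (((2 : ℝ) ^ (n + 1)) ^ p), Real.toNNReal_pos.2 hc, fun Q₀ f hf => ?_⟩
  · exact hf.aestronglyMeasurable.aemeasurable.sub aemeasurable_const
  · have h0 : ENNReal.ofReal (((2 : ℝ) ^ (n + 1)) ^ p) ≠ 0 := by simpa using hc
    change _ ≤ ENNReal.ofReal _ * _
    rw [mul_comm, ← ENNReal.div_le_iff h0 ENNReal.ofReal_ne_top]
    refine le_iInf₂ fun C hC => ?_
    rw [ENNReal.div_le_iff h0 ENNReal.ofReal_ne_top, mul_comm]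
    exact weakLpNorm_subMean_le hp hf hC.1 hC.2
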